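/- Let $q$ be a prime power, and let $\mathrm{PG}(n,q)$ be the $n$-dimensional projective space over $\mathbb{F}_q$. For an integer $m$, a partial $m$-cover of $\mathrm{PG}(n,q)$ is a set $\mathcal{S}$ of $m$ different hyperplanes such that at least one point lies on none of them; the points that lie on no hyperplane of $\mathcal{S}$ are called the holes of $\mathcal{S}$. For an integer $x<(q-2)/3$, let $(A_x)$ be the property: for every integer $b$ with $0\le b\le x$, every partial $(q+b)$-cover of the plane $\mathrm{PG}(2,q)$ with at most $q+b$ holes has at least $q-b$ and at most $q$ holes, and its holes are collinear. Theorem 13. Let $n\ge 2$, let $a$ be an integer with $a<(q-2)/3$, and assume that $(A_x)$ holds for all integers $x\le a$. If $\mathcal{S}$ is a partial $(q+a)$-cover of $\mathrm{PG}(n,q)$ with at most $q^{n-1}$ holes, then all holes of $\mathcal{S}$ are contained in one hyperplane of $\mathrm{PG}(n,q)$. -/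

import Mathlib

/-- The points of the projective space `PG(n, q)`, where `q` is the order of the finite field `F`:
the lines through the origin of `F ^ (n + 1)`. -/
abbrev PGPoint (n : ℕ) (F : Type*) [Field F] : Type _ :=
  Projectivization F (Fin (n + 1) → F)

/-- The hyperplanes of `PG(n, q)`: the projective subspaces of projective dimension `n - 1`, that
is, of vector space dimension `n`. For `n = 2` these are the lines of the plane. -/
abbrev PGHyperplane (n : ℕ) (F : Type*) [Field F] : Type _ :=
  {W : Projectivization.Subspace F (Fin (n + 1) → F) //
    Module.finrank F (Projectivization.Subspace.submodule W) = n}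

/-- The holes of a set of hyperplanes: the points that lie on none of them. -/
def holes {n : ℕ} {F : Type*} [Field F] (S : Finset (PGHyperplane n F)) : Set (PGPoint n F) :=
  {P | ∀ W ∈ S, P ∉ W.1}

/-- A partial `m`-cover: a set of `m` different hyperplanes that has at least one hole. -/
def IsPartialCover {n : ℕ} {F : Type*} [Field F] (m : ℤ) (S : Finset (PGHyperplane n F)) : Prop :=
  (S.card : ℤ) = m ∧ (holes S).Nonempty

/-- Property `(A_x)`, where `q` is the order of `F`: for all integers `b` with `0 ≤ b ≤ x`, every
partial `(q + b)`-cover of the plane `PG(2, q)` with at most `q + b` holes has at least `q - b` and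
at most `q` holes, and its holes are collinear. -/
def PropertyA (F : Type*) [Field F] [Fintype F] (x : ℤ) : Prop :=
  ∀ b : ℤ, 0 ≤ b → b ≤ x → ∀ S : Finset (PGHyperplane 2 F),
    IsPartialCover ((Fintype.card F : ℤ) + b) S →
    ((holes S).ncard : ℤ) ≤ (Fintype.card F : ℤ) + b →
      (Fintype.card F : ℤ) - b ≤ ((holes S).ncard : ℤ) ∧
      (holes S).ncard ≤ Fintype.card F ∧
      Projectivization.IsCollinear (holes S)

/-! Put k = q + a. Hyperplanes become linear forms on V = F^(n+1), and each hole becomes q - 1 hole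
vectors, at which no form vanishes. The bound on a reads 3k + 3 ≤ 4q. If a < 0, every coset of the
line through the origin given by a hole contains a hole vector, which is too many. Let a ≥ 0.

Two facts produce holes. By (A_a), a plane with three noncollinear holes has more than k holes
(`planesHaveManyHoles_of_propertyA`). And a polynomial of degree below 2(q - 1) on F^2 has value sum
zero, so it is not nonzero at exactly one point; hence the holes of an affine plane meet many
parallel lines or are numerous on each one they meet (`two_mul_card_le_rows_add_row`).

Suppose a line with two holes had fewer than q - a of them. Then every plane through it has a hole
off it, and the two facts raise this to q - 1 holes off it. With the two holes on the line this
exceeds q^(n-1), so such a line has at least q - a holes (`two_mul_card_le_of_mem_line`).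

Now project from a hole p. The image D is small, since each of its points has at least q - a - 1
holes above it; it meets every line, and a line with two points of D has at least q - a of them.
Counting shows that D is a subspace (`add_mem_of_forall_line`), proper because it is small, so its
preimage lies in a hyperplane. -/

namespace PartialCover

open Finset
open scoped Classical

/-! ### The polynomial method on an affine plane. -/

section

variable {F : Type*} [Field F] [Fintype F]

/-- Fewer than `2 (q - 1)` affine functions on `F ^ 2` do not isolate a point. -/
theorem exists_ne_forall_affine_ne_zero {ι : Type*} [Fintype ι] (A B C : ι → F) (s t : F)
    (h0 : ∀ i, A i + B i * s + C i * t ≠ 0) (hι : Fintype.card ι < 2 * (Fintype.card F - 1)) :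
    ∃ x : F × F, x ≠ (s, t) ∧ ∀ i, A i + B i * x.1 + C i * x.2 ≠ 0 := by
  by_contra! hcon
  let g : ι → MvPolynomial (Fin 2) F := fun i =>
    MvPolynomial.C (A i) + MvPolynomial.C (B i) * MvPolynomial.X 0 +
      MvPolynomial.C (C i) * MvPolynomial.X 1
  have hg (i : ι) (x : Fin 2 → F) : MvPolynomial.eval x (g i) = A i + B i * x 0 + C i * x 1 := by
    simp [g]
  have hgdeg (i : ι) : (g i).totalDegree ≤ 1 := by
    have hm (c : F) (j : Fin 2) : (MvPolynomial.C c * MvPolynomial.X j).totalDegree ≤ 1 :=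
      (MvPolynomial.totalDegree_mul _ _).trans (by simp [MvPolynomial.totalDegree_X])
    refine (MvPolynomial.totalDegree_add _ _).trans (max_le ?_ (hm _ _))
    exact (MvPolynomial.totalDegree_add _ _).trans (max_le (by simp) (hm _ _))
  have hdeg : (∏ i, g i).totalDegree ≤ Fintype.card ι := by
    refine (MvPolynomial.totalDegree_finsetProd _ _).trans ?_
    exact (sum_le_sum fun i _ => hgdeg i).trans (by simp)
  have hsum := MvPolynomial.sum_eval_eq_zero (∏ i, g i) (by
    rw [Fintype.card_fin]; omega)
  rw [Fintype.sum_eq_single ![s, t]] at hsum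
  · rw [map_prod, prod_eq_zero_iff] at hsum
    obtain ⟨i, -, hi⟩ := hsum
    rw [hg] at hi
    exact h0 i (by simpa using hi)
  · intro x hx
    obtain ⟨i, hi⟩ := hcon (x 0, x 1) (by
      intro h
      apply hx
      simp only [Prod.mk.injEq] at h
      ext j
      fin_cases j <;> simp [h])
    rw [map_prod]
    exact prod_eq_zero (mem_univ i) (by rw [hg]; exact hi)

variable {V : Type*} [AddCommGroup V] [Module F V] {ι : Type*} [Fintype ι]

/-- The points of an affine plane off `card ι` hyperplanes: their number of parallel classes in
one direction and the number of them in one class of this direction cannot both be small. -/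
theorem two_mul_card_le_rows_add_row (l : ι → Module.Dual F V) (w e f : V) (α₀ β₀ : F)
    (h0 : ∀ i, l i (w + α₀ • e + β₀ • f) ≠ 0) :
    2 * Fintype.card F ≤ Fintype.card ι
      + #{β : F | ∃ α : F, ∀ i, l i (w + α • e + β • f) ≠ 0}
      + #{α : F | ∀ i, l i (w + α • e + β₀ • f) ≠ 0} := by
  set T : Finset F := {β : F | ∃ α : F, ∀ i, l i (w + α • e + β • f) ≠ 0} with hT
  set L : Finset F := {α : F | ∀ i, l i (w + α • e + β₀ • f) ≠ 0} with hL
  by_contra! hlt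
  have hβ : β₀ ∈ T := mem_filter.2 ⟨mem_univ _, α₀, h0⟩
  have hα : α₀ ∈ L := mem_filter.2 ⟨mem_univ _, h0⟩
  have hq : 1 < Fintype.card F := Fintype.one_lt_card
  have hTc := card_erase_add_one hβ
  have hLc := card_erase_add_one hα
  -- Adding every other row with a hole and, for every other hole of row `β₀`, a transversal line
  -- through it would isolate `(α₀, β₀)`.
  have key := exists_ne_forall_affine_ne_zero (ι := ι ⊕ (T.erase β₀) ⊕ (L.erase α₀))
    (Sum.elim (fun i => l i w) (Sum.elim (fun b => -b.1) (fun a => -a.1)))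
    (Sum.elim (fun i => l i e) (Sum.elim (fun _ => 0) (fun _ => 1)))
    (Sum.elim (fun i => l i f) (Sum.elim (fun _ => 1) (fun _ => 0))) α₀ β₀ (by
      rintro (i | ⟨b, hb⟩ | ⟨a, ha⟩)
      · have := h0 i
        simp only [map_add, map_smul, smul_eq_mul] at this
        simpa [mul_comm] using this
      · have := ne_of_mem_erase hb
        simp only [Sum.elim_inr, Sum.elim_inl]
        intro h
        apply this
        linear_combination -h
      · have := ne_of_mem_erase ha
        simp only [Sum.elim_inr]
        intro h
        apply this
        linear_combination -h) (by
      simp only [Fintype.card_sum, Fintype.card_coe]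
      omega)
  obtain ⟨⟨s, t⟩, hne, hx⟩ := key
  have hl (i : ι) : l i (w + s • e + t • f) ≠ 0 := by
    have := hx (Sum.inl i)
    simp only [map_add, map_smul, smul_eq_mul]
    simpa [mul_comm] using this
  have ht : t = β₀ := by
    by_contra h
    have := hx (Sum.inr (Sum.inl ⟨t, mem_erase.2 ⟨h, mem_filter.2 ⟨mem_univ _, s, hl⟩⟩⟩))
    simp at this
  subst ht
  have hs : s = α₀ := by
    by_contra h
    have := hx (Sum.inr (Sum.inr ⟨s, mem_erase.2 ⟨h, mem_filter.2 ⟨mem_univ _, hl⟩⟩⟩))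
    simp at this
  exact hne (by rw [hs])

/-- If the line through the holes `u` and `v` has few holes, then each plane through this line has
a hole off the line. -/
theorem exists_mem_coset_of_card_lt (l : ι → Module.Dual F V) {u v : V}
    (hu : ∀ i, l i u ≠ 0)
    (hlt : Fintype.card ι + #{s : F | ∀ i, l i (u + s • v) ≠ 0} + 1 < 2 * Fintype.card F) (y : V) :
    ∃ α β : F, ∀ i, l i (y + α • u + β • v) ≠ 0 := by
  -- Row 0 of this affine plane is the given line; a hole in a row `β ≠ 0` rescales by `β⁻¹` to one
  -- in the coset of `y`.
  have h := two_mul_card_le_rows_add_row l u v y 0 0 (by simpa using hu)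
  by_contra! hcon
  have hT : #{β : F | ∃ α : F, ∀ i, l i (u + α • v + β • y) ≠ 0} ≤ 1 := by
    rw [← card_singleton (0 : F)]
    refine card_le_card fun β hβ => ?_
    simp only [mem_filter, mem_univ, true_and] at hβ
    obtain ⟨α, hα⟩ := hβ
    rw [mem_singleton]
    by_contra hb
    obtain ⟨i, hi⟩ := hcon β⁻¹ (β⁻¹ * α)
    apply hα i
    have : u + α • v + β • y = β • (y + β⁻¹ • u + (β⁻¹ * α) • v) := by
      simp only [smul_add, smul_smul, mul_inv_cancel₀ hb, mul_inv_cancel_left₀ hb, one_smul]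
      abel
    rw [this, map_smul, hi, smul_zero]
  simp only [zero_smul, add_zero] at h
  omega

/-- A plane through a hole `p` has a second hole. -/
theorem exists_second_hole (l : ι → Module.Dual F V) {p : V} (hp : ∀ i, l i p ≠ 0)
    (hlt : Fintype.card ι + 2 < 2 * Fintype.card F) (x y : V) :
    ∃ α β : F, (α, β) ≠ 0 ∧ ∀ i, l i (p + α • x + β • y) ≠ 0 := by
  have h := two_mul_card_le_rows_add_row l p x y 0 0 (by simpa using hp)
  by_contra! hcon
  have hT : #{β : F | ∃ α : F, ∀ i, l i (p + α • x + β • y) ≠ 0} ≤ 1 := by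
    rw [← card_singleton (0 : F)]
    refine card_le_card fun β hβ => ?_
    simp only [mem_filter, mem_univ, true_and] at hβ
    obtain ⟨α, hα⟩ := hβ
    rw [mem_singleton]
    by_contra hb
    obtain ⟨i, hi⟩ := hcon α β (by simp [hb])
    exact hα i hi
  have hL : #{α : F | ∀ i, l i (p + α • x + (0 : F) • y) ≠ 0} ≤ 1 := by
    rw [← card_singleton (0 : F)]
    refine card_le_card fun α hα => ?_
    simp only [mem_filter, mem_univ, true_and] at hα
    rw [mem_singleton]
    by_contra hb
    obtain ⟨i, hi⟩ := hcon α 0 (by simp [hb])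
    exact hα i hi
  omega

end

/-! ### Counting hole vectors by cosets. -/

section

variable {F : Type*} [Field F] [Fintype F]

variable {V : Type*} [AddCommGroup V] [Module F V] {ι : Type*} [Fintype ι]

omit [Fintype F] in
theorem card_inter_add_card_quotient_mul_le [Fintype V] (M : Submodule F V) (D : Finset V) (c : ℕ)
    (hc : ∀ y ∉ M, c ≤ #{z ∈ D | z - y ∈ M}) :
    #{z ∈ D | z ∈ M} + (Nat.card (V ⧸ M) - 1) * c ≤ #D := by
  have : Fintype (V ⧸ M) := Fintype.ofFinite _
  rw [card_eq_sum_card_fiberwise (f := M.mkQ) (t := univ) (s := D)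
      (fun _ _ => mem_coe.2 (mem_univ _)),
    ← add_sum_erase univ _ (mem_univ (0 : V ⧸ M))]
  refine add_le_add (le_of_eq ?_) ?_
  · congr 1
    ext z
    simp
  · rw [Nat.card_eq_fintype_card, ← card_univ, ← card_erase_of_mem (mem_univ (0 : V ⧸ M)),
      ← smul_eq_mul]
    refine card_nsmul_le_sum _ _ _ fun x hx => ?_
    obtain ⟨y, rfl⟩ := M.mkQ_surjective x
    have hy : y ∉ M := by simpa using hx
    refine (hc y hy).trans (le_of_eq ?_)
    congr 1
    ext z
    simp only [mem_filter, and_congr_right_iff]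
    exact fun _ => (Submodule.Quotient.eq M).symm

theorem natCard_quotient [Fintype V] (M : Submodule F V) {d e : ℕ} (hV : Module.finrank F V = d + e)
    (hM : Module.finrank F M = e) : Nat.card (V ⧸ M) = Fintype.card F ^ d := by
  have h := Submodule.finrank_quotient_add_finrank M
  rw [Module.natCard_eq_pow_finrank (K := F), Nat.card_eq_fintype_card]
  congr 1
  omega

theorem pow_lt_card_of_forall_coset [Fintype V] (l : ι → Module.Dual F V) {n : ℕ}
    (hV : Module.finrank F V = (n + 1) + 2) {u v : V} (hi : LinearIndependent F ![u, v])
    (hu : ∀ i, l i u ≠ 0) (hv : ∀ i, l i v ≠ 0)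
    (hlt : Fintype.card ι + #{s : F | ∀ i, l i (u + s • v) ≠ 0} + 1 < 2 * Fintype.card F)
    (hU : ∀ z, (∀ i, l i z ≠ 0) → z ∉ Submodule.span F {u, v} →
      Fintype.card F - 1 ≤ #{x : F × F | ∀ i, l i (z + x.1 • u + x.2 • v) ≠ 0}) :
    (Fintype.card F - 1) * Fintype.card F ^ (n + 1) < #{z : V | ∀ i, l i z ≠ 0} := by
  set M := Submodule.span F {u, v} with hM
  have huM : u ∈ M := Submodule.subset_span (by simp)
  have hvM : v ∈ M := Submodule.subset_span (by simp)
  have hMr : Module.finrank F M = 2 := by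
    have := finrank_span_eq_card hi
    rwa [Matrix.range_cons_cons_empty] at this
  have h := card_inter_add_card_quotient_mul_le M {z : V | ∀ i, l i z ≠ 0} (Fintype.card F - 1) (by
    intro y hy
    obtain ⟨α, β, hz⟩ := exists_mem_coset_of_card_lt l hu hlt y
    have hzy : y + α • u + β • v - y ∈ M := by
      have : y + α • u + β • v - y = α • u + β • v := by abel
      rw [this]
      exact M.add_mem (M.smul_mem _ huM) (M.smul_mem _ hvM)
    set z := y + α • u + β • v
    have hzM : z ∉ M := fun h => hy (by simpa using M.sub_mem h hzy)
    refine (hU z hz hzM).trans ?_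
    refine card_le_card_of_injOn (fun x => z + x.1 • u + x.2 • v) ?_ ?_
    · intro x hx
      simp only [coe_filter, mem_univ, true_and, Set.mem_ofPred_eq, mem_filter] at hx ⊢
      refine ⟨hx, ?_⟩
      have : z + x.1 • u + x.2 • v - y = (z - y) + (x.1 • u + x.2 • v) := by abel
      rw [this]
      exact M.add_mem hzy (M.add_mem (M.smul_mem _ huM) (M.smul_mem _ hvM))
    · intro x _ x' _ hxx
      have h0 : (x.1 - x'.1) • u + (x.2 - x'.2) • v = 0 := by
        simp only [add_assoc, add_right_inj] at hxx
        rw [sub_smul, sub_smul, ← sub_eq_zero.2 hxx]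
        abel
      obtain ⟨h1, h2⟩ := LinearIndependent.pair_iff.1 hi _ _ h0
      exact Prod.ext (sub_eq_zero.1 h1) (sub_eq_zero.1 h2))
  rw [natCard_quotient M hV hMr] at h
  -- The nonzero multiples of `u`, with `v` in place of `0 • u`: one more than q - 1, which makes
  -- the final inequality strict.
  have hin : Fintype.card F ≤ #{z ∈ ({z : V | ∀ i, l i z ≠ 0} : Finset V) | z ∈ M} := by
    rw [← card_univ]
    refine card_le_card_of_injOn (fun s : F => if s = 0 then v else s • u) ?_ ?_
    · intro s _
      by_cases hs : s = 0
      · simp [hs, hv, hvM]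
      · simp [hs, hu, M.smul_mem _ huM]
    · have hvs (s : F) : v ≠ s • u := by
        intro h
        have := LinearIndependent.pair_iff.1 hi s (-1) (by rw [← h]; simp)
        simp at this
      have hu0 : u ≠ 0 := hi.ne_zero 0
      intro s _ t _ hst
      simp only at hst
      split_ifs at hst with h1 h2 h2
      · rw [h1, h2]
      · exact absurd hst (hvs t)
      · exact absurd hst.symm (hvs s)
      · exact smul_left_injective F hu0 hst
  have hq : 1 < Fintype.card F := Fintype.one_lt_card
  have hp : 0 < Fintype.card F ^ (n + 1) := by positivity
  calc (Fintype.card F - 1) * Fintype.card F ^ (n + 1)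
      = (Fintype.card F ^ (n + 1) - 1) * (Fintype.card F - 1) + (Fintype.card F - 1) := by
        rw [← Nat.succ_mul, Nat.succ_eq_add_one, Nat.sub_add_cancel hp, mul_comm]
    _ < _ := by omega

end

/-! ### Lines with at least two holes. -/

section

variable {F : Type*} [Field F] [Fintype F]

variable {V : Type*} [AddCommGroup V] [Module F V] {ι : Type*} [Fintype ι]

omit [Fintype F] in
theorem linearIndependent_pair_of_notMem_span {u v z : V} (hv : v ≠ 0)
    (hz : z ∉ Submodule.span F {u, v}) : LinearIndependent F ![z, v] := by
  rw [LinearIndependent.pair_iff]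
  intro s t h
  have hs : s = 0 := by
    by_contra hs
    refine hz (Submodule.mem_span_pair.2 ⟨0, -(s⁻¹ * t), ?_⟩)
    have : s⁻¹ • (s • z + t • v) = 0 := by rw [h, smul_zero]
    simp only [smul_add, smul_smul, inv_mul_cancel₀ hs, one_smul] at this
    rw [neg_smul, zero_smul, zero_add]
    exact neg_eq_of_add_eq_zero_left this
  subst hs
  refine ⟨rfl, ?_⟩
  rw [zero_smul, zero_add] at h
  exact (smul_eq_zero.1 h).resolve_right hv

/-- A plane has more than `card ι` holes if it contains three noncollinear ones; the holes are
counted in the homogeneous coordinates given by these three, and `v` itself is left out of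
the count. -/
def PlanesHaveManyHoles (l : ι → Module.Dual F V) : Prop :=
  ∀ u v w : V, (∀ i, l i u ≠ 0) → (∀ i, l i v ≠ 0) → (∀ i, l i w ≠ 0) →
    Fintype.card ι ≤ #{s : F | ∀ i, l i (u + s • v) ≠ 0}
      + #{x : F × F | ∀ i, l i (w + x.1 • u + x.2 • v) ≠ 0}

variable [Fintype V] {l : ι → Module.Dual F V} {n : ℕ}

/-- A weak first bound: on a shorter line, `PlanesHaveManyHoles` alone would give q - 1 holes off
the line in each plane. It supplies the lower bounds 2 needed for the sharper result. -/
theorem card_add_two_le_of_mem_line (hl : PlanesHaveManyHoles l)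
    (hk : 3 * Fintype.card ι + 3 ≤ 4 * Fintype.card F)
    (hV : Module.finrank F V = (n + 1) + 2)
    (hZ : #{z : V | ∀ i, l i z ≠ 0} ≤ (Fintype.card F - 1) * Fintype.card F ^ (n + 1))
    {u v : V} (hi : LinearIndependent F ![u, v])
    (hu : ∀ i, l i u ≠ 0) (hv : ∀ i, l i v ≠ 0) :
    Fintype.card ι + 2 ≤ #{s : F | ∀ i, l i (u + s • v) ≠ 0} + Fintype.card F := by
  by_contra! hlt
  refine hZ.not_gt (pow_lt_card_of_forall_coset l hV hi hu hv (by omega) fun z hz hzM => ?_)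
  have := hl u v z hu hv hz
  omega

/-- A line with at least two holes has many holes. -/
theorem two_mul_card_le_of_mem_line (hl : PlanesHaveManyHoles l)
    (hqk : Fintype.card F ≤ Fintype.card ι)
    (hk : 3 * Fintype.card ι + 3 ≤ 4 * Fintype.card F)
    (hV : Module.finrank F V = (n + 1) + 2)
    (hZ : #{z : V | ∀ i, l i z ≠ 0} ≤ (Fintype.card F - 1) * Fintype.card F ^ (n + 1))
    {u v : V} (hi : LinearIndependent F ![u, v])
    (hu : ∀ i, l i u ≠ 0) (hv : ∀ i, l i v ≠ 0) :
    2 * Fintype.card F ≤ Fintype.card ι + #{s : F | ∀ i, l i (u + s • v) ≠ 0} + 1 := by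
  by_contra! hlt
  refine hZ.not_gt (pow_lt_card_of_forall_coset l hV hi hu hv hlt fun z hz hzM => ?_)
  have hu0 : u ≠ 0 := hi.ne_zero 0
  have hv0 : v ≠ 0 := hi.ne_zero 1
  set T : Finset F := {β : F | ∃ α : F, ∀ i, l i (z + α • u + β • v) ≠ 0} with hT
  set f : F → ℕ := fun β => #{α : F | ∀ i, l i (z + α • u + β • v) ≠ 0} with hf
  have hzT : (0 : F) ∈ T := mem_filter.2 ⟨mem_univ _, 0, by simpa using hz⟩
  -- The holes on the line joining `z` and `v` lie in distinct rows; those on a line through `u`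
  -- share a row.
  have hr : 2 ≤ #T := by
    have h := card_add_two_le_of_mem_line hl hk hV hZ
      (linearIndependent_pair_of_notMem_span hv0 hzM) hz hv
    have hle : #{s : F | ∀ i, l i (z + s • v) ≠ 0} ≤ #T := by
      refine card_le_card fun s hs => ?_
      simp only [mem_filter, mem_univ, true_and] at hs
      exact mem_filter.2 ⟨mem_univ _, 0, by simpa using hs⟩
    omega
  have hf2 : ∀ β ∈ T, 2 ≤ f β := by
    intro β hβ
    obtain ⟨α, hα⟩ := (mem_filter.1 hβ).2
    have hzM' : z + α • u + β • v ∉ Submodule.span F {v, u} := by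
      rw [Set.pair_comm]
      intro h
      have huM : u ∈ Submodule.span F {u, v} := Submodule.subset_span (by simp)
      have hvM : v ∈ Submodule.span F {u, v} := Submodule.subset_span (by simp)
      refine hzM ?_
      have := Submodule.sub_mem _ (Submodule.sub_mem _ h (Submodule.smul_mem _ β hvM))
        (Submodule.smul_mem _ α huM)
      simpa using this
    have h := card_add_two_le_of_mem_line hl hk hV hZ
      (linearIndependent_pair_of_notMem_span hu0 hzM') hα hu
    have h' : #{s : F | ∀ i, l i (z + α • u + β • v + s • u) ≠ 0} ≤ f β := by
      refine card_le_card_of_injOn (fun s => α + s) ?_ fun s _ t _ h => add_left_cancel h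
      intro s hs
      simp only [coe_filter, mem_univ, true_and, Set.mem_ofPred_eq] at hs ⊢
      have e1 : z + (α + s) • u + β • v = z + α • u + β • v + s • u := by
        rw [add_smul]
        abel
      rwa [e1]
    omega
  obtain ⟨β₀, hβ₀, hmin⟩ := exists_min_image T f ⟨0, hzT⟩
  have hm := hf2 β₀ hβ₀
  have hgrid : 2 * Fintype.card F ≤ Fintype.card ι + #T + f β₀ := by
    obtain ⟨α, hα⟩ := (mem_filter.1 hβ₀).2
    exact two_mul_card_le_rows_add_row l z u v α β₀ hα
  have hcard : #T * f β₀ ≤ #{x : F × F | ∀ i, l i (z + x.1 • u + x.2 • v) ≠ 0} := by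
    have hmaps : ∀ x ∈ ({x : F × F | ∀ i, l i (z + x.1 • u + x.2 • v) ≠ 0} : Finset (F × F)),
        x.2 ∈ T := fun x hx => mem_filter.2 ⟨mem_univ _, x.1, (mem_filter.1 hx).2⟩
    rw [card_eq_sum_card_fiberwise hmaps, ← smul_eq_mul]
    refine card_nsmul_le_sum _ _ _ fun β hβ => (hmin β hβ).trans ?_
    refine card_le_card_of_injOn (fun α => (α, β)) ?_ ?_
    · intro α hα
      simpa [hf] using hα
    · intro s _ t _ h
      simpa using h
  -- Two factors that are at least 2 with sum at least 2q - k have product at least 2(2q - k) - 4 ≥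
  -- q - 1.
  obtain ⟨r, hr'⟩ := Nat.exists_eq_add_of_le hr
  obtain ⟨m, hm'⟩ := Nat.exists_eq_add_of_le hm
  rw [hr', hm'] at hcard hgrid
  have : (2 + r) * (2 + m) = 4 + 2 * r + 2 * m + r * m := by ring
  omega

end

/-! ### Projection from a hole. -/

section

variable {F : Type*} [Field F] [Fintype F]

variable {V : Type*} [AddCommGroup V] [Module F V] [Fintype V]

/-- Lines through `y` with different directions `u + s • v` share only `y`. -/
theorem one_add_mul_le_card_coset {u v : V} (hi : LinearIndependent F ![u, v]) {D : Finset V}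
    {y : V} (hy : y ∈ D) {m b : ℕ} (hm : m ≤ #{s : F | u + s • v ∈ D})
    (hb : ∀ s : F, u + s • v ∈ D → b ≤ #{r : F | r ≠ 0 ∧ y + r • (u + s • v) ∈ D}) :
    1 + m * b ≤ #{z ∈ D | z - y ∈ Submodule.span F {u, v}} := by
  let A : Finset F := {s : F | u + s • v ∈ D}
  let B : F → Finset F := fun s => {r : F | r ≠ 0 ∧ y + r • (u + s • v) ∈ D}
  let g : (Σ _ : F, F) → V := fun x => y + x.2 • (u + x.1 • v)
  have hg : Set.InjOn g (A.sigma B) := by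
    rintro ⟨s, r⟩ hx ⟨s', r'⟩ - h
    have hr : r ≠ 0 := (mem_filter.1 (mem_sigma.1 (mem_coe.1 hx)).2).2.1
    simp only [g, add_right_inj, smul_add, smul_smul] at h
    have h0 : (r - r') • u + (r * s - r' * s') • v = 0 := by
      rw [sub_smul, sub_smul, ← sub_eq_zero.2 h]
      abel
    obtain ⟨h1, h2⟩ := LinearIndependent.pair_iff.1 hi _ _ h0
    obtain rfl : r = r' := sub_eq_zero.1 h1
    rw [← mul_sub] at h2
    obtain rfl : s = s' := sub_eq_zero.1 ((mul_eq_zero.1 h2).resolve_left hr)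
    rfl
  have hyg : y ∉ (A.sigma B).image g := by
    simp only [mem_image, mem_sigma, not_exists, not_and]
    rintro ⟨s, r⟩ ⟨-, hr⟩ h
    simp only [g, smul_add, smul_smul, add_eq_left] at h
    exact (mem_filter.1 hr).2.1 (LinearIndependent.pair_iff.1 hi _ _ h).1
  have hsub : insert y ((A.sigma B).image g) ⊆ {z ∈ D | z - y ∈ Submodule.span F {u, v}} := by
    intro z hz
    rw [mem_insert, mem_image] at hz
    rcases hz with rfl | ⟨⟨s, r⟩, hx, rfl⟩
    · simp [hy]
    · rw [mem_sigma] at hx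
      refine mem_filter.2 ⟨(mem_filter.1 hx.2).2.2, Submodule.mem_span_pair.2 ⟨r, r * s, ?_⟩⟩
      simp [g, smul_add, smul_smul]
  have hcard := card_le_card hsub
  rw [card_insert_of_notMem hyg, card_image_of_injOn hg, card_sigma] at hcard
  have : #A * b ≤ ∑ s ∈ A, #(B s) := by
    rw [← smul_eq_mul]
    exact card_nsmul_le_sum _ _ _ fun s hs => hb s (mem_filter.1 hs).2
  have hmA : m * b ≤ #A * b := Nat.mul_le_mul_right b hm
  omega

/-- A small set of lines through the origin that meets every plane and that contains large parts of
the planes that it meets in two lines is a subspace. -/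
theorem add_mem_of_forall_line {D : Finset V} {m d : ℕ} (hV : Module.finrank F V = d + 2)
    (hsmul : ∀ (c : F), ∀ x ∈ D, c • x ∈ D) (hq : 3 ≤ Fintype.card F)
    (hm : 2 * Fintype.card F ≤ 3 * m)
    (hline : ∀ u ∈ D, ∀ v ∈ D, LinearIndependent F ![u, v] → m ≤ #{s : F | u + s • v ∈ D})
    (hmeet : ∀ x ∉ D, ∀ y, ∃ s : F, y + s • x ∈ D)
    (hcard : m * (#D - 1) + (Fintype.card F - 1) ≤
      (Fintype.card F - 1) * Fintype.card F ^ (d + 1))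
    {u v : V} (hu : u ∈ D) (hv : v ∈ D) : u + v ∈ D := by
  by_contra huv
  have hi : LinearIndependent F ![u, v] := by
    rw [LinearIndependent.pair_iff]
    intro s t h
    have ht : t = 0 := by
      by_contra ht
      apply huv
      have : u + v = (1 - t⁻¹ * s) • u := by
        have h' : t⁻¹ • (s • u + t • v) = 0 := by rw [h, smul_zero]
        simp only [smul_add, smul_smul, inv_mul_cancel₀ ht, one_smul] at h'
        rw [sub_smul, one_smul, sub_eq_add_neg, neg_eq_of_add_eq_zero_right h']
      rw [this]
      exact hsmul _ _ hu
    subst ht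
    refine ⟨?_, rfl⟩
    by_contra hs
    rw [zero_smul, add_zero] at h
    rw [(smul_eq_zero.1 h).resolve_left hs, zero_add] at huv
    exact huv hv
  have h0 : (0 : V) ∈ D := by simpa using hsmul 0 u hu
  set E := Submodule.span F {u, v} with hE
  have huE : u ∈ E := Submodule.subset_span (by simp)
  have hvE : v ∈ E := Submodule.subset_span (by simp)
  have hEr : Module.finrank F E = 2 := by
    have := finrank_span_eq_card hi
    rwa [Matrix.range_cons_cons_empty] at this
  -- As `u + v` is off `D`, every coset of `E` meets `D`; from a common point, m directions each
  -- lead to m - 1 further points.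
  have hcount := card_inter_add_card_quotient_mul_le E D (1 + m * (m - 1)) (by
    intro y hy
    obtain ⟨s, hs⟩ := hmeet _ huv y
    have hsE : s • (u + v) ∈ E := E.smul_mem _ (E.add_mem huE hvE)
    have hyE : y + s • (u + v) ∉ E := fun h => hy (by simpa using E.sub_mem h hsE)
    refine (one_add_mul_le_card_coset hi hs (hline u hu v hv hi) fun t ht => ?_).trans
      (le_of_eq ?_)
    · have hne : u + t • v ≠ 0 := by
        intro h
        have := LinearIndependent.pair_iff.1 hi 1 t (by simpa using h)
        simp at this
      have huvE : u + t • v ∈ E := E.add_mem huE (E.smul_mem _ hvE)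
      have hi' : LinearIndependent F ![y + s • (u + v), u + t • v] := by
        refine linearIndependent_pair_of_notMem_span (u := 0) hne fun h => hyE ?_
        refine Submodule.span_le.2 ?_ h
        rintro z (rfl | rfl)
        · exact E.zero_mem
        · exact huvE
      have hl := hline _ hs _ ht hi'
      have h0' : (0 : F) ∈ ({r : F | y + s • (u + v) + r • (u + t • v) ∈ D} : Finset F) := by
        simpa using hs
      rw [← card_erase_add_one h0'] at hl
      refine (Nat.sub_le_iff_le_add.2 hl).trans (card_le_card fun r hr => ?_)
      rw [mem_erase, mem_filter] at hr
      exact mem_filter.2 ⟨mem_univ _, hr.1, hr.2.2⟩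
    · congr 1
      ext z
      simp only [mem_filter, and_congr_right_iff]
      intro _
      have : z - y = z - (y + s • (u + v)) + s • (u + v) := by abel
      rw [this]
      exact (E.add_mem_iff_left hsE).symm)
  have hcoset := one_add_mul_le_card_coset (b := Fintype.card F - 1) hi h0 (hline u hu v hv hi) (by
    intro s hs
    rw [← card_univ, ← card_erase_of_mem (mem_univ (0 : F))]
    refine card_le_card fun r hr => ?_
    refine mem_filter.2 ⟨mem_univ _, ne_of_mem_erase hr, ?_⟩
    rw [zero_add]
    exact hsmul _ _ hs)
  simp only [sub_zero, ← hE] at hcoset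
  rw [natCard_quotient E hV hEr] at hcount
  have hX : 0 < Fintype.card F ^ d := by positivity
  rw [pow_succ] at hcard
  obtain ⟨Y, hY⟩ := Nat.exists_eq_add_of_le' (show 1 ≤ Fintype.card F ^ d from hX)
  obtain ⟨p, hp⟩ := Nat.exists_eq_add_of_le' (show 1 ≤ Fintype.card F by omega)
  obtain ⟨j, hj⟩ := Nat.exists_eq_add_of_le' (show 2 ≤ m by omega)
  obtain ⟨e, he⟩ := Nat.exists_eq_add_of_le' (show 1 ≤ #D from card_pos.2 ⟨0, h0⟩)
  rw [hY, hj] at hcount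
  rw [hp, hj] at hcoset
  rw [hY, hp, hj, he] at hcard
  rw [hp, hj] at hm
  simp only [Nat.add_sub_cancel, show j + 2 - 1 = j + 1 by omega] at hcount hcoset hcard
  have he' : (j + 2) * p + Y * (1 + (j + 2) * (j + 1)) ≤ e := by omega
  -- Here p = q - 1 and j = m - 2. This is where 2q ≤ 3m is needed: q(q - 1) ≤ m(1 + m(m - 1)), with
  -- equality for q = 3, m = 2.
  have h1 : p * (p + 1) ≤ (j + 2) * (1 + (j + 2) * (j + 1)) := by
    have : 2 * (p + 1) ≤ 3 * j + 6 := by omega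
    have : 2 * p ≤ 3 * j + 4 := by omega
    nlinarith [Nat.mul_le_mul ‹2 * (p + 1) ≤ 3 * j + 6› ‹2 * p ≤ 3 * j + 4›,
      Nat.zero_le (j * j * j), Nat.zero_le (j * j)]
  have h2 : (j + 2) * ((j + 2) * p + Y * (1 + (j + 2) * (j + 1))) ≤ (j + 2) * e :=
    Nat.mul_le_mul_left _ he'
  have h3 : Y * (p * (p + 1)) ≤ Y * ((j + 2) * (1 + (j + 2) * (j + 1))) :=
    Nat.mul_le_mul_left _ h1
  have h4 : p * (p + 1) ≤ p * ((j + 2) * (j + 2)) := by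
    refine Nat.mul_le_mul_left _ ?_
    nlinarith
  have hp1 : 2 ≤ p := by omega
  nlinarith

variable {ι : Type*} [Fintype ι] {l : ι → Module.Dual F V} {d : ℕ}

/-- If planes spanned by holes have many holes, then few holes lie in one hyperplane. -/
theorem exists_hyperplane_of_card_le (hl : PlanesHaveManyHoles l)
    (hqk : Fintype.card F ≤ Fintype.card ι)
    (hk : 3 * Fintype.card ι + 3 ≤ 4 * Fintype.card F)
    (hV : Module.finrank F V = (d + 1) + 2)
    (hZ : #{z : V | ∀ i, l i z ≠ 0} ≤ (Fintype.card F - 1) * Fintype.card F ^ (d + 1))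
    {p : V} (hp : ∀ i, l i p ≠ 0) :
    ∃ g : Module.Dual F V, g ≠ 0 ∧ ∀ z, (∀ i, l i z ≠ 0) → g z = 0 := by
  have hι : Nonempty ι := Fintype.card_pos_iff.1 (by omega)
  have hp0 : p ≠ 0 := by
    rintro rfl
    exact hp hι.some (map_zero _)
  let N := Submodule.span F {p}
  have : Fintype (V ⧸ N) := Fintype.ofFinite _
  let Z : Finset V := {z : V | ∀ i, l i z ≠ 0}
  let D : Finset (V ⧸ N) := Z.image N.mkQ
  have hpN : N.mkQ p = 0 := by simp [N, Submodule.mem_span_singleton_self]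
  have hZsmul (c : F) (hc : c ≠ 0) (z : V) (hz : ∀ i, l i z ≠ 0) (i : ι) : l i (c • z) ≠ 0 := by
    rw [map_smul]
    exact smul_ne_zero hc (hz i)
  have hD (z : V) (hz : ∀ i, l i z ≠ 0) : N.mkQ z ∈ D :=
    mem_image_of_mem _ (mem_filter.2 ⟨mem_univ _, hz⟩)
  have h0 : (0 : V ⧸ N) ∈ D := hpN ▸ hD p hp
  have hDsmul : ∀ (c : F), ∀ x ∈ D, c • x ∈ D := by
    intro c x hx
    obtain ⟨z, hz, rfl⟩ := mem_image.1 hx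
    by_cases hc : c = 0
    · rw [hc, zero_smul]
      exact h0
    · rw [← map_smul]
      exact hD _ (hZsmul c hc z (mem_filter.1 hz).2)
  have hVr : Module.finrank F (V ⧸ N) = d + 2 := by
    have h1 := Submodule.finrank_quotient_add_finrank N
    have h2 : Module.finrank F N = 1 := finrank_span_singleton hp0
    omega
  -- So m = 2q - 1 - k, and 2q ≤ 3m is exactly 3k + 3 ≤ 4q.
  obtain ⟨m, hm⟩ : ∃ m, m + Fintype.card ι + 1 = 2 * Fintype.card F :=
    ⟨2 * Fintype.card F - 1 - Fintype.card ι, by omega⟩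
  have hline : ∀ u ∈ D, ∀ v ∈ D, LinearIndependent F ![u, v] →
      m ≤ #{s : F | u + s • v ∈ D} := by
    intro u hu v hv hi
    obtain ⟨u, hu', rfl⟩ := mem_image.1 hu
    obtain ⟨v, hv', rfl⟩ := mem_image.1 hv
    have hi' : LinearIndependent F ![u, v] := by
      rw [LinearIndependent.pair_iff] at hi ⊢
      intro s t h
      exact hi s t (by rw [← map_smul, ← map_smul, ← map_add, h, map_zero])
    have h := two_mul_card_le_of_mem_line hl hqk hk hV hZ hi' (mem_filter.1 hu').2
      (mem_filter.1 hv').2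
    refine le_trans (b := #{s : F | ∀ i, l i (u + s • v) ≠ 0}) (by omega)
      (card_le_card fun s hs => ?_)
    rw [mem_filter] at hs ⊢
    refine ⟨hs.1, ?_⟩
    rw [← map_smul, ← map_add]
    exact hD _ hs.2
  have hmeet : ∀ x ∉ D, ∀ y, ∃ s : F, y + s • x ∈ D := by
    intro x hx y
    obtain ⟨x, rfl⟩ := N.mkQ_surjective x
    obtain ⟨y, rfl⟩ := N.mkQ_surjective y
    obtain ⟨α, β, hne, h⟩ := exists_second_hole l hp (by omega) x y
    have hmem := hD _ h
    rw [map_add, map_add, hpN, zero_add, map_smul, map_smul] at hmem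
    have hβ : β ≠ 0 := by
      rintro rfl
      have hα : α ≠ 0 := by rintro rfl; exact hne rfl
      have := hDsmul α⁻¹ _ hmem
      rw [zero_smul, add_zero, smul_smul, inv_mul_cancel₀ hα, one_smul] at this
      exact hx this
    refine ⟨β⁻¹ * α, ?_⟩
    have := hDsmul β⁻¹ _ hmem
    rwa [smul_add, smul_smul, smul_smul, inv_mul_cancel₀ hβ, one_smul, add_comm] at this
  -- Over each nonzero element of `D` lie at least m hole vectors, over zero at least the q - 1
  -- nonzero multiples of `p`.
  have hcard : m * (#D - 1) + (Fintype.card F - 1) ≤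
      (Fintype.card F - 1) * Fintype.card F ^ (d + 1) := by
    refine le_trans ?_ hZ
    rw [card_eq_sum_card_image N.mkQ, ← add_sum_erase _ _ h0, add_comm, ← card_erase_of_mem h0,
      mul_comm, ← smul_eq_mul]
    refine add_le_add ?_ (card_nsmul_le_sum _ _ _ fun x hx => ?_)
    · rw [← card_univ, ← card_erase_of_mem (mem_univ (0 : F))]
      refine card_le_card_of_injOn (fun r => r • p) ?_ ?_
      · intro r hr
        have hr := ne_of_mem_erase hr
        simp only [coe_filter, mem_filter, mem_univ, true_and, Set.mem_ofPred_eq]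
        exact ⟨hZsmul r hr p hp, by rw [map_smul, hpN, smul_zero]⟩
      · exact (smul_left_injective F hp0).injOn
    · obtain ⟨hx0, hx⟩ := mem_erase.1 hx
      obtain ⟨z, hz, rfl⟩ := mem_image.1 hx
      have hzN : z ∉ Submodule.span F {p, p} := by
        rw [Set.pair_eq_singleton]
        intro h
        exact hx0 (by simpa using h)
      have h := two_mul_card_le_of_mem_line hl hqk hk hV hZ
        (linearIndependent_pair_of_notMem_span hp0 hzN) (mem_filter.1 hz).2 hp
      refine le_trans (b := #{s : F | ∀ i, l i (z + s • p) ≠ 0}) (by omega) ?_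
      refine card_le_card_of_injOn (fun s => z + s • p) ?_ ?_
      · intro s hs
        simp only [coe_filter, mem_filter, mem_univ, true_and, Set.mem_ofPred_eq] at hs ⊢
        exact ⟨hs, by rw [map_add, map_smul, hpN, smul_zero, add_zero]⟩
      · intro s _ t _ h
        exact smul_left_injective F hp0 (add_left_cancel h)
  let W : Submodule F (V ⧸ N) :=
    { carrier := D
      add_mem' := fun hu hv => add_mem_of_forall_line hVr hDsmul (by omega) (by omega) hline hmeet
        hcard hu hv
      zero_mem' := h0
      smul_mem' := fun c x hx => hDsmul c x hx }
  have hW : W < ⊤ := by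
    refine lt_top_iff_ne_top.2 fun h => ?_
    have hDu : D = univ := by
      ext x
      have : x ∈ W := h ▸ Submodule.mem_top
      exact iff_of_true this (mem_univ _)
    rw [hDu, card_univ, ← Nat.card_eq_fintype_card, Module.natCard_eq_pow_finrank (K := F), hVr,
      Nat.card_eq_fintype_card, pow_succ] at hcard
    have hX : 0 < Fintype.card F ^ (d + 1) := by positivity
    have hm2 : 2 ≤ m := by omega
    have h1 := Nat.mul_le_mul_right (Fintype.card F ^ (d + 1) * Fintype.card F - 1) hm2
    have h2 : (Fintype.card F - 1) * Fintype.card F ^ (d + 1) + Fintype.card F ^ (d + 1) =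
        Fintype.card F ^ (d + 1) * Fintype.card F := by
      rw [← Nat.succ_mul, Nat.succ_eq_add_one, Nat.sub_add_cancel (by omega), mul_comm]
    have h3 := Nat.mul_le_mul hX (show 3 ≤ Fintype.card F by omega)
    omega
  obtain ⟨g, hg, hle⟩ := W.exists_le_ker_of_lt_top hW
  refine ⟨g ∘ₗ N.mkQ, fun h => hg ?_, fun z hz => hle (hD z hz)⟩
  ext x
  exact LinearMap.congr_fun h x

end

/-! ### Hyperplanes as linear forms, and the use of (A_x). -/

section

variable {F : Type*} [Field F]

theorem exists_dual_of_hyperplane {n : ℕ} (W : PGHyperplane n F) :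
    ∃ g : Module.Dual F (Fin (n + 1) → F), ∀ v (hv : v ≠ 0),
      Projectivization.mk F v hv ∈ W.1 ↔ g v = 0 := by
  set M := Projectivization.Subspace.submodule W.1 with hM
  have hMn : Module.finrank F M = n := W.2
  have hlt : M < ⊤ := by
    refine lt_top_iff_ne_top.2 fun h => ?_
    rw [h, finrank_top, Module.finrank_fin_fun] at hMn
    omega
  obtain ⟨g, hg, hle⟩ := M.exists_le_ker_of_lt_top hlt
  have hker : Module.finrank F (LinearMap.ker g) = n := by
    have := Module.Dual.finrank_ker_add_one_of_ne_zero hg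
    rw [Module.finrank_fin_fun] at this
    omega
  have heq := Submodule.eq_of_le_of_finrank_eq hle (hMn.trans hker.symm)
  refine ⟨g, fun v hv => ?_⟩
  rw [← Projectivization.Subspace.mem_submodule_iff _ hv, ← hM, heq, LinearMap.mem_ker]

theorem exists_hyperplane_of_dual {n : ℕ} {g : Module.Dual F (Fin (n + 1) → F)} (hg : g ≠ 0) :
    ∃ W : PGHyperplane n F, ∀ v (hv : v ≠ 0), Projectivization.mk F v hv ∈ W.1 ↔ g v = 0 := by
  refine ⟨⟨(LinearMap.ker g).projectivization, ?_⟩, fun v hv => ?_⟩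
  · have := Module.Dual.finrank_ker_add_one_of_ne_zero hg
    rw [Module.finrank_fin_fun] at this
    rw [OrderIso.apply_symm_apply]
    omega
  · rw [Submodule.mk_mem_projectivization_iff, LinearMap.mem_ker]

theorem mk_mem_holes_iff {n : ℕ} {S : Finset (PGHyperplane n F)} {v : Fin (n + 1) → F}
    {hv : v ≠ 0} : Projectivization.mk F v hv ∈ holes S ↔
      ∀ W ∈ S, Projectivization.mk F v hv ∉ W.1 := Iff.rfl

/-- The vertices of the coordinate triangle are not collinear. -/
theorem not_isCollinear_of_single_mem {H : Set (PGPoint 2 F)}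
    (h : ∀ j : Fin 3, Projectivization.mk F (Pi.single j 1) (by simp) ∈ H) :
    ¬ Projectivization.IsCollinear H := by
  rintro ⟨M, -, hM, hsub⟩
  have htop : Projectivization.Subspace.submodule M = ⊤ := by
    refine eq_top_iff.2 ?_
    rw [← (Pi.basisFun F (Fin 3)).span_eq, Submodule.span_le]
    rintro _ ⟨j, rfl⟩
    rw [Pi.basisFun_apply]
    exact (Projectivization.Subspace.mem_submodule_iff M _).2 (hsub (h j))
  rw [htop, finrank_top, Module.finrank_fin_fun] at hM
  omega

variable [Fintype F]

/-- There are `(q - 1) ^ 2` lines that miss the vertices of the coordinate triangle. -/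
theorem exists_lines_missing_triangle : ∃ G : Finset (PGHyperplane 2 F),
    #G = (Fintype.card F - 1) * (Fintype.card F - 1) ∧
      ∀ W ∈ G, ∀ j : Fin 3, Projectivization.mk F (Pi.single j 1) (by simp) ∉ W.1 := by
  let g : Fˣ × Fˣ → Module.Dual F (Fin 3 → F) := fun x =>
    LinearMap.proj 0 + (x.1 : F) • LinearMap.proj 1 + (x.2 : F) • LinearMap.proj 2
  have hg (x : Fˣ × Fˣ) (c : Fin 3 → F) : g x c = c 0 + x.1 * c 1 + x.2 * c 2 := by
    simp [g]
  have hgj (x : Fˣ × Fˣ) (j : Fin 3) : g x (Pi.single j 1) ≠ 0 := by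
    rw [hg]
    fin_cases j <;> simp
  have hg0 (x : Fˣ × Fˣ) : g x ≠ 0 := fun h => hgj x 0 (by rw [h]; rfl)
  choose W hW using fun x => exists_hyperplane_of_dual (hg0 x)
  refine ⟨univ.image W, ?_, ?_⟩
  · rw [card_image_of_injective, card_univ, Fintype.card_prod, Fintype.card_units]
    intro x y hxy
    have h1 : (![(x.1 : F), -1, 0] : Fin 3 → F) ≠ 0 := fun h => by
      simpa using congrFun h 1
    have h2 : (![(x.2 : F), 0, -1] : Fin 3 → F) ≠ 0 := fun h => by
      simpa using congrFun h 2
    have e1 := (hW y _ h1).1 (hxy ▸ (hW x _ h1).2 (by rw [hg]; simp))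
    have e2 := (hW y _ h2).1 (hxy ▸ (hW x _ h2).2 (by rw [hg]; simp))
    rw [hg] at e1 e2
    refine Prod.ext (Units.ext ?_) (Units.ext ?_)
    · simp at e1
      linear_combination e1
    · simp at e2
      linear_combination e2
  · intro L hL j hj
    obtain ⟨x, -, rfl⟩ := mem_image.1 hL
    exact hgj x j ((hW x _ _).1 hj)

theorem ncard_le_of_forall_mk {H : Set (PGPoint 2 F)} {P : (Fin 3 → F) → Prop}
    (hP : ∀ (c : F) (x : Fin 3 → F), c ≠ 0 → P x → P (c • x))
    (hH : ∀ x (hx : x ≠ 0), Projectivization.mk F x hx ∈ H → P x) :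
    H.ncard ≤ 1 + #{s : F | P ![1, s, 0]} + #{x : F × F | P ![x.1, x.2, 1]} := by
  have h1 (s : F) : (![1, s, 0] : Fin 3 → F) ≠ 0 := fun h => by simpa using congrFun h 0
  have h2 (x : F × F) : (![x.1, x.2, 1] : Fin 3 → F) ≠ 0 := fun h => by
    simpa using congrFun h 2
  have h3 : (![0, 1, 0] : Fin 3 → F) ≠ 0 := fun h => by simpa using congrFun h 1
  let K : Finset (PGPoint 2 F) :=
    ({Projectivization.mk F _ h3} ∪
      ({s : F | P ![1, s, 0]} : Finset F).image fun s => Projectivization.mk F _ (h1 s)) ∪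
      ({x : F × F | P ![x.1, x.2, 1]} : Finset (F × F)).image
        fun x => Projectivization.mk F _ (h2 x)
  have hsub : H ⊆ K := by
    intro Q hQ
    induction Q using Projectivization.ind with
    | h c hc =>
      have hPc := hH c hc hQ
      simp only [K, coe_union, coe_singleton, coe_image, coe_filter, mem_univ, true_and,
        Set.mem_union, Set.mem_singleton_iff, Set.mem_image, Set.mem_ofPred_eq,
        Projectivization.mk_eq_mk_iff']
      by_cases hc2 : c 2 = 0
      · by_cases hc0 : c 0 = 0
        · refine Or.inl (Or.inl ⟨c 1, ?_⟩)
          ext j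
          fin_cases j <;> simp [hc2, hc0]
        · have e : (c 0)⁻¹ • c = ![1, (c 0)⁻¹ * c 1, 0] := by
            ext j
            fin_cases j <;> simp [hc2, hc0]
          refine Or.inl (Or.inr ⟨(c 0)⁻¹ * c 1, ?_, (c 0)⁻¹, e⟩)
          rw [← e]
          exact hP _ _ (inv_ne_zero hc0) hPc
      · have e : (c 2)⁻¹ • c = ![(c 2)⁻¹ * c 0, (c 2)⁻¹ * c 1, 1] := by
          ext j
          fin_cases j <;> simp [hc2]
        refine Or.inr ⟨((c 2)⁻¹ * c 0, (c 2)⁻¹ * c 1), ?_, (c 2)⁻¹, e⟩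
        rw [← e]
        exact hP _ _ (inv_ne_zero hc2) hPc
  calc H.ncard ≤ (K : Set (PGPoint 2 F)).ncard := Set.ncard_le_ncard hsub K.finite_toSet
    _ = #K := Set.ncard_coe_finset K
    _ ≤ _ := by
      refine (card_union_le _ _).trans (add_le_add ((card_union_le _ _).trans
        (add_le_add (by simp) card_image_le)) card_image_le)

variable {V : Type*} [AddCommGroup V] [Module F V] {ι : Type*} [Fintype ι]

/-- The forms are pulled back to F^3, so `u`, `v`, `w` need not be independent. The resulting lines
may coincide; lines missing the coordinate triangle bring their number back to k and only remove
holes. With at most k holes left, (A_a) for b = a would make the three vertices collinear. -/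
theorem planesHaveManyHoles_of_propertyA {a : ℤ} (ha : 0 ≤ a) (hA : PropertyA F a)
    (hk : 3 * Fintype.card ι + 3 ≤ 4 * Fintype.card F)
    (hι : (Fintype.card ι : ℤ) = Fintype.card F + a) (l : ι → Module.Dual F V) :
    PlanesHaveManyHoles l := by
  intro u v w hu hv hw
  let φ : (Fin 3 → F) →ₗ[F] V := Fintype.linearCombination F ![u, v, w]
  have hφ (c : Fin 3 → F) : φ c = c 0 • u + c 1 • v + c 2 • w := by
    simp [φ, Fintype.linearCombination_apply, Fin.sum_univ_three]
  have hφj (i : ι) (j : Fin 3) : l i (φ (Pi.single j 1)) ≠ 0 := by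
    rw [hφ]
    fin_cases j <;> simp [hu i, hv i, hw i]
  have hne (i : ι) : (l i ∘ₗ φ) ≠ 0 := fun h => hφj i 0 (LinearMap.congr_fun h _)
  choose W hW using fun i => exists_hyperplane_of_dual (hne i)
  obtain ⟨G, hGc, hG⟩ := exists_lines_missing_triangle (F := F)
  have hTc : #(univ.image W) ≤ Fintype.card ι := card_image_le
  have hGk : Fintype.card ι ≤ #(univ.image W ∪ G) := by
    refine le_trans ?_ (card_le_card subset_union_right)
    rw [hGc]
    obtain ⟨p, hp⟩ := Nat.exists_eq_add_of_le' (show 3 ≤ Fintype.card F by omega)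
    rw [hp] at hk ⊢
    rw [show p + 3 - 1 = p + 2 by omega]
    nlinarith
  obtain ⟨S, hTS, hSG, hSc⟩ := exists_subsuperset_card_eq subset_union_left hTc hGk
  have hvert (j : Fin 3) : Projectivization.mk F (Pi.single j 1) (by simp) ∈ holes S := by
    intro L hL
    rcases mem_union.1 (hSG hL) with h | h
    · obtain ⟨i, -, rfl⟩ := mem_image.1 h
      exact fun h => hφj i j ((hW i _ _).1 h)
    · exact hG L h j
  have hlow : Fintype.card ι < (holes S).ncard := by
    by_contra! hle
    exact not_isCollinear_of_single_mem hvert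
      (hA a ha le_rfl S ⟨by rw [hSc, hι], ⟨_, hvert 0⟩⟩ (by omega)).2.2
  have hup := ncard_le_of_forall_mk (H := holes S) (P := fun c => ∀ i, l i (φ c) ≠ 0)
    (fun c x hc hx i => by
      rw [map_smul, map_smul]
      exact smul_ne_zero hc (hx i))
    (fun x hx h i hi => h (W i) (hTS (mem_image_of_mem _ (mem_univ i))) ((hW i x hx).2 hi))
  have e1 (s : F) : φ ![1, s, 0] = u + s • v := by simp [hφ]
  have e2 (x : F × F) : φ ![x.1, x.2, 1] = w + x.1 • u + x.2 • v := by
    simp [hφ]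
    abel
  simp only [e1, e2] at hup
  omega

/-- Fewer than `q` hyperplanes that miss a point leave at least `q ^ d` vectors uncovered,
in a space of dimension `d + 1`. -/
theorem pow_le_card_of_card_lt [Fintype V] {d : ℕ} (hV : Module.finrank F V = d + 1)
    (l : ι → Module.Dual F V) (hk : Fintype.card ι < Fintype.card F) {p : V} (hp0 : p ≠ 0)
    (hp : ∀ i, l i p ≠ 0) : Fintype.card F ^ d ≤ #{z : V | ∀ i, l i z ≠ 0} := by
  -- Each form excludes only one value of `s`.
  have hmeet (y : V) : ∃ s : F, ∀ i, l i (y + s • p) ≠ 0 := by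
    have hc : #(univ.image fun i => -(l i y / l i p)) < Fintype.card F :=
      card_image_le.trans_lt hk
    obtain ⟨s, hs⟩ := exists_mem_notMem_of_card_lt_card (hc.trans_eq card_univ.symm)
    refine ⟨s, fun i hi => hs.2 (mem_image.2 ⟨i, mem_univ i, ?_⟩)⟩
    rw [map_add, map_smul, smul_eq_mul] at hi
    have := hp i
    field_simp
    linear_combination -hi
  have h := card_inter_add_card_quotient_mul_le (Submodule.span F {p}) {z : V | ∀ i, l i z ≠ 0} 1
    (by
      intro y _
      obtain ⟨s, hs⟩ := hmeet y
      refine card_pos.2 ⟨y + s • p, mem_filter.2 ⟨mem_filter.2 ⟨mem_univ _, hs⟩, ?_⟩⟩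
      rw [add_sub_cancel_left]
      exact Submodule.smul_mem _ _ (Submodule.mem_span_singleton_self p))
  rw [natCard_quotient _ hV (finrank_span_singleton hp0)] at h
  have : 0 < #{z ∈ ({z : V | ∀ i, l i z ≠ 0} : Finset V) | z ∈ Submodule.span F {p}} :=
    card_pos.2 ⟨p, mem_filter.2 ⟨mem_filter.2 ⟨mem_univ _, hp⟩,
      Submodule.mem_span_singleton_self p⟩⟩
  omega

theorem card_erase_zero_le {n : ℕ} (H : Set (PGPoint n F)) (Z : Finset (Fin (n + 1) → F))
    (hZ : ∀ z ∈ Z, ∀ hz : z ≠ 0, Projectivization.mk F z hz ∈ H) :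
    #(Z.erase 0) ≤ (Fintype.card F - 1) * H.ncard := by
  have hfin : H.Finite := Set.toFinite H
  have hsub : Z.erase 0 ⊆
      ((univ : Finset Fˣ) ×ˢ hfin.toFinset).image fun x => (x.1 : F) • x.2.rep := by
    intro z hz
    obtain ⟨hz0, hz⟩ := mem_erase.1 hz
    obtain ⟨c, hc⟩ := Projectivization.exists_smul_eq_mk_rep F z hz0
    refine mem_image.2 ⟨(c⁻¹, Projectivization.mk F z hz0), ?_, ?_⟩
    · exact mem_product.2 ⟨mem_univ _, hfin.mem_toFinset.2 (hZ z hz hz0)⟩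
    · simp only [← hc]
      exact inv_smul_smul c z
  refine (card_le_card hsub).trans (card_image_le.trans (le_of_eq ?_))
  rw [card_product, card_univ, Fintype.card_units, Set.ncard_eq_toFinset_card H hfin]

end

end PartialCover

theorem theorem13 (F : Type*) [Field F] [Fintype F] (n : ℕ) (hn : 2 ≤ n) (a : ℤ)
    (ha : (a : ℝ) < ((Fintype.card F : ℝ) - 2) / 3)
    (hA : ∀ x : ℤ, x ≤ a → PropertyA F x)
    (S : Finset (PGHyperplane n F))
    (hS : IsPartialCover ((Fintype.card F : ℤ) + a) S)
    (hH : (holes S).ncard ≤ Fintype.card F ^ (n - 1)) :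
    ∃ W : PGHyperplane n F, holes S ⊆ (W.1 : Set (PGPoint n F)) := by
  classical
  obtain ⟨d, rfl⟩ := Nat.exists_eq_add_of_le' hn
  rw [show d + 2 - 1 = d + 1 by omega] at hH
  choose g hg using fun W : PGHyperplane (d + 2) F => PartialCover.exists_dual_of_hyperplane W
  let l : S → Module.Dual F (Fin (d + 2 + 1) → F) := fun W => g W.1
  have hl (z : Fin (d + 2 + 1) → F) (hz : z ≠ 0) :
      Projectivization.mk F z hz ∈ holes S ↔ ∀ i, l i z ≠ 0 := by
    rw [PartialCover.mk_mem_holes_iff]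
    exact ⟨fun h i hi => h i.1 i.2 ((hg _ z hz).2 hi),
      fun h W hW hW' => h ⟨W, hW⟩ ((hg W z hz).1 hW')⟩
  obtain ⟨P, hP⟩ := hS.2
  have hp : ∀ i, l i P.rep ≠ 0 := by
    rw [← hl _ P.rep_nonzero, P.mk_rep]
    exact hP
  have hk : (Fintype.card S : ℤ) = Fintype.card F + a := by
    rw [Fintype.card_coe]
    exact hS.1
  have ha' : 3 * a + 2 < Fintype.card F := by
    have : (3 * a + 2 : ℝ) < Fintype.card F := by linarith
    exact_mod_cast this
  let Z : Finset (Fin (d + 2 + 1) → F) := {z | ∀ i, l i z ≠ 0}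
  have hZ : (Z.erase 0).card ≤ (Fintype.card F - 1) * Fintype.card F ^ (d + 1) :=
    (PartialCover.card_erase_zero_le (holes S) Z fun z hz hz0 =>
      (hl z hz0).2 (Finset.mem_filter.1 hz).2).trans (Nat.mul_le_mul_left _ hH)
  have hV : Module.finrank F (Fin (d + 2 + 1) → F) = d + 2 + 1 := Module.finrank_fin_fun F
  have hq : 1 < Fintype.card F := Fintype.one_lt_card
  have ha0 : 0 ≤ a := by
    by_contra! hneg
    have h1 : Fintype.card F ^ (d + 2) ≤ Z.card :=
      PartialCover.pow_le_card_of_card_lt hV l (by omega) P.rep_nonzero hp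
    -- If `S` is empty, `Z` contains 0; this loss of one is absorbed by `h4`.
    have h2 : Z.card - 1 ≤ (Z.erase 0).card := Finset.pred_card_le_card_erase
    have h3 : (Fintype.card F - 1) * Fintype.card F ^ (d + 1) + Fintype.card F ^ (d + 1) =
        Fintype.card F ^ (d + 2) := by
      rw [← Nat.succ_mul, Nat.succ_eq_add_one, Nat.sub_add_cancel hq.le, pow_succ' _ (d + 1)]
    have h4 : 1 < Fintype.card F ^ (d + 1) := Nat.one_lt_pow (by omega) hq
    omega
  have hZ0 : (0 : Fin (d + 2 + 1) → F) ∉ Z := by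
    have : Nonempty S := Fintype.card_pos_iff.1 (by omega)
    exact fun h => (Finset.mem_filter.1 h).2 this.some (map_zero _)
  rw [Finset.erase_eq_of_notMem hZ0] at hZ
  obtain ⟨f, hf, hfZ⟩ := PartialCover.exists_hyperplane_of_card_le
    (PartialCover.planesHaveManyHoles_of_propertyA ha0 (hA a le_rfl) (by omega) hk l)
    (by omega) (by omega) hV hZ hp
  obtain ⟨W, hW⟩ := PartialCover.exists_hyperplane_of_dual hf
  refine ⟨W, fun Q hQ => ?_⟩
  induction Q using Projectivization.ind with
  | h v hv => exact (hW v hv).2 (hfZ v ((hl v hv).1 hQ))
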